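/- Let $G$ be a simple graph on $n$ vertices (the agents) whose complement is connected, with $0/1$ adjacency matrix $(g_{ij})$, and let $\lambda_n$ be the largest eigenvalue of its Laplacian matrix. The state $x\in\mathbb{R}^n$ is distributed as $N(\mu\mathbf{1}_n,\sigma^2 I_n)$, with $\mu\in\mathbb{R}$ and $\sigma>0$. A public signal is a Markov kernel $\varphi$ from $\mathbb{R}^n$ to a measurable space $M$. After a common realization $m\in M$, each agent $i$ chooses $a_i\in\mathbb{R}$ to maximize the posterior expectation of $-(a_i-x_i)^2-\beta\sum_{j}g_{ij}(a_i-a_j)^2$, and a Nash equilibrium results. The principal's payoff is that of the complete synergy graph $\widetilde G=K_n$, namely $-\sum_i(a_i-x_i)^2-\beta\sum_{i}\sum_{j\ne i}(a_i-a_j)^2$. A signal is optimal if it maximizes the principal's expected equilibrium payoff among all public signals. A signal informs the agents of a variable $y$ if $\mathbb{E}[y\mid m]=y$ almost surely. Write $\bar x=\frac1n\sum_i x_i$. Then $\lambda_n<n$, and for every $\beta>\frac{1}{2(n-\lambda_n)}$ (hence for all sufficiently large $\beta$) the optimal signal informs the agents only of the average state. Precisely: the signal that discloses exactly $\bar x$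 is optimal; a public signal is optimal if and only if $\mathbb{E}[x_i\mid m]=\bar x$ almost surely for every $i$; and every optimal signal informs the agents of $\bar x$, and informs them of a linear statistic $\sum_i c_i x_i$ if and only if $c_1=\dots=c_n$. -/

import Mathlib

open MeasureTheory ProbabilityTheory
open scoped NNReal

universe u v

noncomputable section

namespace QuadraticTeam

/-- Largest eigenvalue `λ_n` of the Laplacian matrix of `G`. -/
def laplacianSpectralRadius {n : ℕ} (G : SimpleGraph (Fin n)) [DecidableRel G.Adj] : ℝ :=
  sSup {lam : ℝ | Module.End.HasEigenvalue (Matrix.toLin' (G.lapMatrix ℝ)) lam}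

/-- The law `N(μ 1, σ² I)` of the state: i.i.d. normal coordinates. -/
def prior (n : ℕ) (μ : ℝ) (σ : ℝ≥0) : Measure (Fin n → ℝ) :=
  Measure.pi fun _ => gaussianReal μ (σ ^ 2)

instance (n : ℕ) (μ : ℝ) (σ : ℝ≥0) : IsProbabilityMeasure (prior n μ σ) := by
  unfold prior; infer_instance

/-- The average state. -/
def average {n : ℕ} (x : Fin n → ℝ) : ℝ := (∑ i, x i) / n

/-- Payoff of agent `i` at actions `a` and state `x`, for the incentive graph `G`. -/
def agentPayoff {n : ℕ} (G : SimpleGraph (Fin n)) [DecidableRel G.Adj] (β : ℝ)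
    (i : Fin n) (a x : Fin n → ℝ) : ℝ :=
  -(a i - x i) ^ 2 - β * ∑ j, G.adjMatrix ℝ i j * (a i - a j) ^ 2

/-- Payoff of the principal at actions `a` and state `x`, for the synergy graph `H`. -/
def principalPayoff {n : ℕ} (H : SimpleGraph (Fin n)) [DecidableRel H.Adj] (β : ℝ)
    (a x : Fin n → ℝ) : ℝ :=
  -(∑ i, (a i - x i) ^ 2) - β * ∑ i, ∑ j, H.adjMatrix ℝ i j * (a i - a j) ^ 2

section Signals

variable {n : ℕ} {M : Type u} [MeasurableSpace M]

/-- Law of the signal realization, when the state has law `P` and the signal is `φ`. -/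
def signalLaw (P : Measure (Fin n → ℝ)) (φ : Kernel (Fin n → ℝ) M) : Measure M :=
  P.bind φ

/-- Public expectation `E[f(x) | m]` of a function of the state after realization `m`: the
integral against the common posterior. -/
def condExpect (P : Measure (Fin n → ℝ)) [IsFiniteMeasure P] (φ : Kernel (Fin n → ℝ) M)
    [IsMarkovKernel φ] (f : (Fin n → ℝ) → ℝ) (m : M) : ℝ :=
  ∫ x, f x ∂(posterior φ P m)

/-- The signal informs the agents of the variable `y = f(x)`: `E[y | m] = y` almost surely under
the joint law of state and realization. -/
def Informs (P : Measure (Fin n → ℝ)) [IsFiniteMeasure P] (φ : Kernel (Fin n → ℝ) M)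
    [IsMarkovKernel φ] (f : (Fin n → ℝ) → ℝ) : Prop :=
  ∀ᵐ p ∂(P.compProd φ), condExpect P φ f p.2 = f p.1

/-- `a` is a Nash equilibrium of the game induced by the public signal `φ`: after almost every
realization `m`, each agent's action maximizes the expected payoff under the common posterior,
given the actions of the others. -/
def IsEquilibrium (G : SimpleGraph (Fin n)) [DecidableRel G.Adj] (β : ℝ)
    (P : Measure (Fin n → ℝ)) [IsFiniteMeasure P] (φ : Kernel (Fin n → ℝ) M)
    [IsMarkovKernel φ] (a : M → Fin n → ℝ) : Prop :=
  Measurable a ∧ ∀ᵐ m ∂(signalLaw P φ), ∀ (i : Fin n) (b : ℝ),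
    condExpect P φ (agentPayoff G β i (Function.update (a m) i b)) m ≤
      condExpect P φ (agentPayoff G β i (a m)) m

/-- Ex ante expected payoff of the principal under the signal `φ` and the strategies `a`. -/
def principalValue (H : SimpleGraph (Fin n)) [DecidableRel H.Adj] (β : ℝ)
    (P : Measure (Fin n → ℝ)) (φ : Kernel (Fin n → ℝ) M) (a : M → Fin n → ℝ) : ℝ :=
  ∫ p, principalPayoff H β (a p.2) p.1 ∂(P.compProd φ)

/-- `φ` is an optimal public signal: it induces an equilibrium, and the principal's expected
payoff in equilibrium is at least the one in any equilibrium under any other public signal, with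
values in any measurable space. -/
def IsOptimalSignal (G H : SimpleGraph (Fin n)) [DecidableRel G.Adj] [DecidableRel H.Adj] (β : ℝ)
    (P : Measure (Fin n → ℝ)) [IsFiniteMeasure P] (φ : Kernel (Fin n → ℝ) M)
    [IsMarkovKernel φ] : Prop :=
  (∃ a : M → Fin n → ℝ, IsEquilibrium G β P φ a) ∧
    ∀ a : M → Fin n → ℝ, IsEquilibrium G β P φ a →
      ∀ (N : Type v) [MeasurableSpace N] (ψ : Kernel (Fin n → ℝ) N) [IsMarkovKernel ψ]
        (b : N → Fin n → ℝ), IsEquilibrium G β P ψ b →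
        principalValue H β P ψ b ≤ principalValue H β P φ a

end Signals

theorem measurable_average {n : ℕ} : Measurable (average : (Fin n → ℝ) → ℝ) := by
  unfold average; fun_prop

/-- The signal that discloses exactly the average state. -/
def averageSignal (n : ℕ) : Kernel (Fin n → ℝ) ℝ :=
  Kernel.deterministic average measurable_average

instance (n : ℕ) : IsMarkovKernel (averageSignal n) := by
  unfold averageSignal; infer_instance

end QuadraticTeam

end

/-! ### Laplacian quadratic forms and the equilibrium system -/

namespace QuadraticTeam

open Matrix

section LinearAlgebra

variable {n : ℕ} (G : SimpleGraph (Fin n)) [DecidableRel G.Adj]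

/-! Write L for the Laplacian of G and θ for the vector of posterior means. First-order conditions
turn equilibrium into the linear system (I + βL)a = θ (`isEquilibrium_iff`), which has a unique
solution. L kills constants and its columns sum to zero, so a and θ have the same average.

In the principal's expected payoff, the tower property lets θ = (I + βL)a replace x in the cross
term. Split a into its average ā and its deviation d. Apart from -∑ x_i², the payoff becomes nā² +
|d|² + 2β d·Ld - 2βn|d|², which is at most nā² - (2β(n - λ_n) - 1)|d|² (`teamPayoff_le`). Above the
threshold on β the coefficient of |d|² is strictly negative. Also E[ā²] ≤ E[x̄²], because ā is the
posterior mean of x̄. Hence no signal beats the value E[n x̄² - ∑ x_i²], and equality forces d = 0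
and ā = x̄ almost surely, that is, θ = x̄·1 (`principalValue_eq_iff`).

The bound is attained: i.i.d. coordinates are exchangeable, so disclosing x̄ gives E[x_i | x̄] = x̄
(`condExpect_deterministic_average`). Such a signal predicts ∑ c_i x_i by (∑ c_i) x̄. As the prior
is nondegenerate, this prediction is exact only when c is constant. -/

lemma sum_adjMatrix_mul_sq (a : Fin n → ℝ) :
    ∑ i, ∑ j, G.adjMatrix ℝ i j * (a i - a j) ^ 2 = 2 * (a ⬝ᵥ (G.lapMatrix ℝ *ᵥ a)) := by
  have h := G.lapMatrix_toLinearMap₂' ℝ a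
  rw [Matrix.toLinearMap₂'_apply'] at h
  rw [h]
  simp only [SimpleGraph.adjMatrix_apply, ite_mul, one_mul, zero_mul]
  ring

lemma sum_sum_sub_sq (a : Fin n → ℝ) :
    ∑ i, ∑ j, (a i - a j) ^ 2 = 2 * (n * (a ⬝ᵥ a) - (∑ i, a i) ^ 2) := by
  have h : ∀ i j, (a i - a j) ^ 2 = a i * a i - 2 * (a i * a j) + a j * a j := fun i j => by ring
  simp_rw [h, Finset.sum_add_distrib, Finset.sum_sub_distrib]
  simp only [Finset.sum_const, Finset.card_univ, Fintype.card_fin, nsmul_eq_mul, dotProduct,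
    ← Finset.mul_sum, ← Finset.sum_mul]
  ring

/-- Each pair of distinct vertices is an edge of exactly one of G and its complement. In matrix
form, the two Laplacians add up to nI - J, with J the all-ones matrix. -/
lemma sum_adjMatrix_add_compl (a : Fin n → ℝ) :
    ∑ i, ∑ j, G.adjMatrix ℝ i j * (a i - a j) ^ 2
      + ∑ i, ∑ j, Gᶜ.adjMatrix ℝ i j * (a i - a j) ^ 2
      = 2 * (n * (a ⬝ᵥ a) - (∑ i, a i) ^ 2) := by
  rw [← sum_sum_sub_sq, ← Finset.sum_add_distrib]
  refine Finset.sum_congr rfl fun i _ => ?_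
  rw [← Finset.sum_add_distrib]
  refine Finset.sum_congr rfl fun j _ => ?_
  by_cases hij : i = j
  · simp [hij]
  · by_cases h : G.Adj i j <;> simp [SimpleGraph.adjMatrix_apply, h, hij]

lemma sum_adjMatrix_top (a : Fin n → ℝ) :
    ∑ i, ∑ j, (⊤ : SimpleGraph (Fin n)).adjMatrix ℝ i j * (a i - a j) ^ 2
      = 2 * (n * (a ⬝ᵥ a) - (∑ i, a i) ^ 2) := by
  rw [← sum_sum_sub_sq]
  refine Finset.sum_congr rfl fun i _ => Finset.sum_congr rfl fun j _ => ?_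
  by_cases hij : i = j <;> simp [SimpleGraph.adjMatrix_apply, hij]

lemma lapMatrix_mulVec_const (t : ℝ) : G.lapMatrix ℝ *ᵥ (fun _ => t) = 0 :=
  (G.lapMatrix_mulVec_eq_zero_iff_forall_adj).2 fun _ _ _ => rfl

lemma sum_lapMatrix_mulVec (a : Fin n → ℝ) : ∑ i, (G.lapMatrix ℝ *ᵥ a) i = 0 := by
  have h : ∑ i, (G.lapMatrix ℝ *ᵥ a) i = (fun _ => (1 : ℝ)) ⬝ᵥ (G.lapMatrix ℝ *ᵥ a) := by
    simp [dotProduct]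
  rw [h, dotProduct_mulVec, ← mulVec_transpose, (G.isSymm_lapMatrix (R := ℝ)).eq,
    lapMatrix_mulVec_const, zero_dotProduct]

/-- If t ≥ n, the complement identity forces an eigenvector to have zero sum and zero energy on the
complement. Zero energy on a connected graph means constant, so the vector vanishes. -/
lemma hasEigenvalue_lapMatrix_lt (hG : Gᶜ.Connected) {t : ℝ}
    (ht : Module.End.HasEigenvalue (Matrix.toLin' (G.lapMatrix ℝ)) t) : t < n := by
  obtain ⟨x, hx⟩ := ht.exists_hasEigenvector
  have hLx : G.lapMatrix ℝ *ᵥ x = t • x := by simpa using hx.apply_eq_smul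
  by_contra! hle
  have h1 := sum_adjMatrix_add_compl G x
  rw [sum_adjMatrix_mul_sq, sum_adjMatrix_mul_sq, hLx, dotProduct_smul, smul_eq_mul] at h1
  have h2 : 0 ≤ x ⬝ᵥ (Gᶜ.lapMatrix ℝ *ᵥ x) := by
    simpa using (SimpleGraph.posSemidef_lapMatrix ℝ Gᶜ).dotProduct_mulVec_nonneg x
  have h3 : 0 ≤ x ⬝ᵥ x := by simpa using dotProduct_star_self_nonneg x
  have h4 : 0 ≤ (t - n) * (x ⬝ᵥ x) := mul_nonneg (by linarith) h3
  have h5 : x ⬝ᵥ (Gᶜ.lapMatrix ℝ *ᵥ x) = 0 := by nlinarith [sq_nonneg (∑ i, x i)]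
  have h6 : (∑ i, x i) = 0 := by
    have : (∑ i, x i) ^ 2 ≤ 0 := by nlinarith
    simpa using le_antisymm this (sq_nonneg _)
  rw [← Matrix.toLinearMap₂'_apply',
    SimpleGraph.lapMatrix_toLinearMap₂'_apply'_eq_zero_iff_forall_reachable] at h5
  refine hx.2 (funext fun i => ?_)
  have h7 : ∀ j, x j = x i := fun j => h5 j i (hG.preconnected j i)
  simp only [h7, Finset.sum_const, Finset.card_univ, Fintype.card_fin, nsmul_eq_mul] at h6
  have : (n : ℝ) ≠ 0 := by
    have := i.pos
    positivity
  simpa [this] using h6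

lemma finite_eigenvalues_lapMatrix :
    {t : ℝ | Module.End.HasEigenvalue (Matrix.toLin' (G.lapMatrix ℝ)) t}.Finite :=
  Module.End.finite_hasEigenvalue _

lemma laplacianSpectralRadius_lt (hG : Gᶜ.Connected) : laplacianSpectralRadius G < n := by
  have hne : Nonempty (Fin n) := hG.nonempty
  -- The eigenvalue 0 makes the spectrum nonempty; being finite, it contains its supremum, so the
  -- strict bound survives.
  have h0 : Module.End.HasEigenvalue (Matrix.toLin' (G.lapMatrix ℝ)) (0 : ℝ) := by
    refine Module.End.hasEigenvalue_of_hasEigenvector (x := fun _ => 1) ⟨?_, ?_⟩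
    · simp [lapMatrix_mulVec_const]
    · exact fun h => one_ne_zero (congrFun h hne.some)
  exact hasEigenvalue_lapMatrix_lt G hG
    (Set.Nonempty.csSup_mem ⟨0, h0⟩ (finite_eigenvalues_lapMatrix G))

/-- The Rayleigh bound: every eigenvalue of rI - L is r minus an eigenvalue of L, hence nonnegative
when r is the top of the spectrum. -/
lemma dotProduct_lapMatrix_le (a : Fin n → ℝ) :
    a ⬝ᵥ (G.lapMatrix ℝ *ᵥ a) ≤ laplacianSpectralRadius G * (a ⬝ᵥ a) := by
  set r := laplacianSpectralRadius G with hr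
  have hH : (r • (1 : Matrix (Fin n) (Fin n) ℝ) - G.lapMatrix ℝ).IsHermitian := by
    refine IsHermitian.sub ?_ (G.isHermitian_lapMatrix ℝ)
    simp [IsHermitian]
  have hpsd : (r • (1 : Matrix (Fin n) (Fin n) ℝ) - G.lapMatrix ℝ).PosSemidef := by
    rw [hH.posSemidef_iff_eigenvalues_nonneg]
    intro j
    have hv := hH.mulVec_eigenvectorBasis j
    have hne : hH.eigenvectorBasis j ≠ 0 := hH.eigenvectorBasis.orthonormal.ne_zero j
    have h1 : Module.End.HasEigenvalue (Matrix.toLin' (G.lapMatrix ℝ)) (r - hH.eigenvalues j) := by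
      refine Module.End.hasEigenvalue_of_hasEigenvector
        (x := WithLp.ofLp (hH.eigenvectorBasis j)) ⟨?_, ?_⟩
      · rw [Module.End.mem_eigenspace_iff, Matrix.toLin'_apply, sub_smul, ← hv, sub_mulVec,
          smul_mulVec, one_mulVec]
        abel
      · exact fun h => hne (by ext i; exact congrFun h i)
    have h2 := le_csSup (finite_eigenvalues_lapMatrix G).bddAbove h1
    have h3 : r - hH.eigenvalues j ≤ r := h2
    simp only [Pi.zero_apply]
    linarith
  have h := hpsd.dotProduct_mulVec_nonneg a
  simp only [star_trivial, sub_mulVec, smul_mulVec, one_mulVec, dotProduct_sub, dotProduct_smul,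
    smul_eq_mul] at h
  linarith

/-- The matrix of the linear system that an equilibrium solves. -/
noncomputable def bestReplyMatrix (β : ℝ) : Matrix (Fin n) (Fin n) ℝ := 1 + β • G.lapMatrix ℝ

lemma bestReplyMatrix_mulVec (β : ℝ) (a : Fin n → ℝ) :
    bestReplyMatrix G β *ᵥ a = a + β • (G.lapMatrix ℝ *ᵥ a) := by
  simp [bestReplyMatrix, add_mulVec, smul_mulVec]

lemma bestReplyMatrix_mulVec_const (β t : ℝ) :
    bestReplyMatrix G β *ᵥ (fun _ => t) = fun _ => t := by
  simp [bestReplyMatrix_mulVec, lapMatrix_mulVec_const]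

lemma average_bestReplyMatrix_mulVec (β : ℝ) (a : Fin n → ℝ) :
    average (bestReplyMatrix G β *ᵥ a) = average a := by
  simp [average, bestReplyMatrix_mulVec, Finset.sum_add_distrib, ← Finset.mul_sum,
    sum_lapMatrix_mulVec]

/-- Identity plus a positive semidefinite matrix is positive definite. This gives existence and
almost sure uniqueness of equilibrium. -/
lemma isUnit_bestReplyMatrix {β : ℝ} (hβ : 0 ≤ β) : IsUnit (bestReplyMatrix G β) :=
  (PosDef.one.add_posSemidef ((SimpleGraph.posSemidef_lapMatrix ℝ G).smul hβ)).isUnit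

/-- The centred part of an action profile. -/
noncomputable def deviation (a : Fin n → ℝ) : Fin n → ℝ := fun i => a i - average a

lemma dotProduct_self_eq_average_add_deviation (hn : n ≠ 0) (a : Fin n → ℝ) :
    a ⬝ᵥ a = n * average a ^ 2 + deviation a ⬝ᵥ deviation a := by
  have hs : ∑ i, a i = n * average a := by
    rw [average]; field_simp
  have : deviation a ⬝ᵥ deviation a
      = ∑ i, (a i * a i - 2 * average a * a i + average a ^ 2) :=
    Finset.sum_congr rfl fun i _ => by simp only [deviation]; ring
  rw [this, Finset.sum_add_distrib, Finset.sum_sub_distrib, ← Finset.mul_sum, hs]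
  simp [dotProduct]
  ring

lemma dotProduct_lapMatrix_deviation (a : Fin n → ℝ) :
    deviation a ⬝ᵥ (G.lapMatrix ℝ *ᵥ deviation a) = a ⬝ᵥ (G.lapMatrix ℝ *ᵥ a) := by
  have h1 := sum_adjMatrix_mul_sq G a
  have h2 := sum_adjMatrix_mul_sq G (deviation a)
  simp only [deviation, sub_sub_sub_cancel_right] at h2
  rw [h1] at h2
  linarith

/-- The equilibrium payoff density is bounded by its value on constant profiles. -/
lemma teamPayoff_le (hn : n ≠ 0) {β : ℝ} (hβ : 0 ≤ β) (a : Fin n → ℝ) :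
    2 * (a ⬝ᵥ (bestReplyMatrix G β *ᵥ a)) - a ⬝ᵥ a
        - β * ∑ i, ∑ j, (⊤ : SimpleGraph (Fin n)).adjMatrix ℝ i j * (a i - a j) ^ 2
      ≤ n * average a ^ 2
        - (2 * β * (n - laplacianSpectralRadius G) - 1) * (deviation a ⬝ᵥ deviation a) := by
  have h1 := dotProduct_self_eq_average_add_deviation hn a
  have h2 := dotProduct_lapMatrix_le G (deviation a)
  rw [dotProduct_lapMatrix_deviation] at h2
  have hs : ∑ i, a i = n * average a := by
    rw [average]; field_simp
  rw [sum_adjMatrix_top, bestReplyMatrix_mulVec, dotProduct_add, dotProduct_smul, smul_eq_mul, hs]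
  rw [h1]
  -- With d the deviation, the left side is now n ā² + |d|² + 2β a·La - 2βn|d|²; only a·La ≤ λ_n|d|²
  -- remains to be used.
  have h3 := mul_le_mul_of_nonneg_left h2 hβ
  nlinarith

end LinearAlgebra

end QuadraticTeam

/-! ### Posterior expectations: square integrability and the tower property -/

namespace QuadraticTeam

lemma average_eq_sum {n : ℕ} (x : Fin n → ℝ) : average x = ∑ i, (1 / (n : ℝ)) * x i := by
  rw [average, ← Finset.mul_sum]; ring

lemma memLp_average {n : ℕ} {P : Measure (Fin n → ℝ)}
    (hP : ∀ i, MemLp (fun x : Fin n → ℝ => x i) 2 P) :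
    MemLp (average : (Fin n → ℝ) → ℝ) 2 P := by
  have : (average : (Fin n → ℝ) → ℝ) = fun x => ∑ i, (1 / (n : ℝ)) * x i :=
    funext average_eq_sum
  rw [this]
  exact memLp_finsetSum _ fun i _ => (hP i).const_mul _

section Posterior

variable {n : ℕ} {M : Type u} [MeasurableSpace M] {P : Measure (Fin n → ℝ)}
  [IsProbabilityMeasure P] (φ : Kernel (Fin n → ℝ) M) [IsMarkovKernel φ]
  {f g : (Fin n → ℝ) → ℝ}

lemma measurePreserving_fst_compProd :
    MeasurePreserving Prod.fst (P.compProd φ) P :=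
  ⟨measurable_fst, Measure.fst_compProd P φ⟩

lemma measurePreserving_snd_compProd :
    MeasurePreserving Prod.snd (P.compProd φ) (signalLaw P φ) :=
  ⟨measurable_snd, Measure.snd_compProd P φ⟩

instance : IsProbabilityMeasure (signalLaw P φ) := by
  unfold signalLaw; infer_instance

lemma posterior_comp_signalLaw : (posterior φ P) ∘ₘ (signalLaw P φ) = P :=
  posterior_comp_self

lemma ae_integrable_posterior (hf : Integrable f P) :
    ∀ᵐ m ∂(signalLaw P φ), Integrable f (posterior φ P m) := by
  rw [← posterior_comp_signalLaw (P := P) φ] at hf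
  exact Measure.ae_integrable_of_integrable_comp hf

lemma measurable_condExpect (hf : Measurable f) : Measurable (condExpect P φ f) :=
  (hf.stronglyMeasurable.integral_kernel (κ := posterior φ P)).measurable

lemma integrable_condExpect (hfm : Measurable f) (hf : Integrable f P) :
    Integrable (condExpect P φ f) (signalLaw P φ) := by
  rw [← posterior_comp_signalLaw (P := P) φ] at hf
  exact (Measure.integrable_integral_norm_of_integrable_comp hf).mono'
    (measurable_condExpect φ hfm).aestronglyMeasurable
    (Filter.Eventually.of_forall fun m => norm_integral_le_integral_norm _)

/-- Nonnegativity of the posterior variance bounds the squared posterior mean by the posterior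
second moment, which is integrable. -/
lemma memLp_condExpect (hfm : Measurable f) (hf : MemLp f 2 P) :
    MemLp (condExpect P φ f) 2 (signalLaw P φ) := by
  rw [memLp_two_iff_integrable_sq (measurable_condExpect φ hfm).aestronglyMeasurable]
  refine (integrable_condExpect φ (hfm.pow_const 2) hf.integrable_sq).mono'
    ((measurable_condExpect φ hfm).pow_const 2).aestronglyMeasurable ?_
  filter_upwards [ae_integrable_posterior φ (hf.integrable one_le_two),
    ae_integrable_posterior φ hf.integrable_sq] with m h1 h2
  have h : 0 ≤ Var[f; posterior φ P m] := variance_nonneg _ _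
  rw [variance_eq_sub ((memLp_two_iff_integrable_sq h1.1).2 h2)] at h
  rw [Real.norm_of_nonneg (sq_nonneg _)]
  simpa [condExpect] using h

/-- Tower property under the joint law of state and realization. -/
lemma integral_mul_condExpect {h : M → ℝ}
    (hhf : Integrable (fun p : (Fin n → ℝ) × M => h p.2 * f p.1) (P.compProd φ))
    (hh : Measurable h) (hfm : Measurable f) :
    ∫ p, h p.2 * f p.1 ∂(P.compProd φ) = ∫ m, h m * condExpect P φ f m ∂(signalLaw P φ) := by
  -- Bayes' rule: the joint law also disintegrates as realization first, then posterior.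
  have hsw : (signalLaw P φ) ⊗ₘ (posterior φ P) = (P ⊗ₘ φ).map Prod.swap :=
    compProd_posterior_eq_map_swap
  have hmeas : Measurable fun q : M × (Fin n → ℝ) => h q.1 * f q.2 := by fun_prop
  have h1 : ∫ q, h q.1 * f q.2 ∂((signalLaw P φ) ⊗ₘ (posterior φ P))
      = ∫ p, h p.2 * f p.1 ∂(P.compProd φ) := by
    rw [hsw, integral_map measurable_swap.aemeasurable hmeas.aestronglyMeasurable]
    rfl
  have h2 : Integrable (fun q : M × (Fin n → ℝ) => h q.1 * f q.2)
      ((signalLaw P φ) ⊗ₘ (posterior φ P)) := by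
    rw [hsw, integrable_map_measure hmeas.aestronglyMeasurable measurable_swap.aemeasurable]
    exact hhf
  rw [← h1, Measure.integral_compProd h2]
  simp only [integral_const_mul, condExpect]

lemma memLp_fst (hf : MemLp f 2 P) :
    MemLp (fun p : (Fin n → ℝ) × M => f p.1) 2 (P.compProd φ) :=
  hf.comp_measurePreserving (measurePreserving_fst_compProd φ)

lemma memLp_snd {h : M → ℝ} (hh : MemLp h 2 (signalLaw P φ)) :
    MemLp (fun p : (Fin n → ℝ) × M => h p.2) 2 (P.compProd φ) :=
  hh.comp_measurePreserving (measurePreserving_snd_compProd φ)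

lemma ae_snd {p : M → Prop} (h : ∀ᵐ m ∂(signalLaw P φ), p m) :
    ∀ᵐ q ∂(P.compProd φ), p q.2 :=
  (measurePreserving_snd_compProd (P := P) φ).quasiMeasurePreserving.ae h

lemma integral_snd_mul_fst (hfm : Measurable f) (hf : MemLp f 2 P) {h : M → ℝ}
    (hhm : Measurable h) (hh : MemLp h 2 (signalLaw P φ)) :
    ∫ p, h p.2 * f p.1 ∂(P.compProd φ) = ∫ p, h p.2 * condExpect P φ f p.2 ∂(P.compProd φ) := by
  rw [integral_mul_condExpect φ
    ((memLp_snd φ hh).integrable_mul (memLp_fst φ hf)) hhm hfm,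
    ← (measurePreserving_snd_compProd (P := P) φ).map_eq,
    integral_map measurable_snd.aemeasurable (Measurable.aestronglyMeasurable
      (f := fun m => h m * condExpect P φ f m) (hhm.mul (measurable_condExpect φ hfm)))]

/-- Posterior means of the coordinates of the state. -/
noncomputable def posteriorMean (P : Measure (Fin n → ℝ)) [IsFiniteMeasure P] (φ : Kernel (Fin n → ℝ) M)
    [IsMarkovKernel φ] (m : M) : Fin n → ℝ :=
  fun i => condExpect P φ (fun x => x i) m

lemma measurable_posteriorMean : Measurable (posteriorMean P φ) :=
  measurable_pi_lambda _ fun i => measurable_condExpect φ (measurable_pi_apply i)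

/-- Only integrability of the n coordinates is needed, so a single null set serves every c. -/
lemma condExpect_linear (hP : ∀ i, MemLp (fun x : Fin n → ℝ => x i) 2 P) :
    ∀ᵐ m ∂(signalLaw P φ), ∀ c : Fin n → ℝ,
      condExpect P φ (fun x => ∑ i, c i * x i) m = ∑ i, c i * posteriorMean P φ m i := by
  have h : ∀ᵐ m ∂(signalLaw P φ), ∀ i,
      Integrable (fun x : Fin n → ℝ => x i) (posterior φ P m) :=
    ae_all_iff.2 fun i => ae_integrable_posterior φ ((hP i).integrable one_le_two)
  filter_upwards [h] with m hm c
  simp only [condExpect, posteriorMean]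
  rw [integral_finsetSum _ fun i _ => (hm i).const_mul (c i)]
  simp only [integral_const_mul]

lemma condExpect_average (hP : ∀ i, MemLp (fun x : Fin n → ℝ => x i) 2 P) :
    ∀ᵐ m ∂(signalLaw P φ), condExpect P φ average m = average (posteriorMean P φ m) := by
  filter_upwards [condExpect_linear φ hP] with m hm
  rw [average_eq_sum, ← hm]
  exact congrArg (fun f => condExpect P φ f m) (funext average_eq_sum)

end Posterior

end QuadraticTeam

/-! ### Equilibrium as a linear system in the posterior means -/

namespace QuadraticTeam

open Matrix

section Equilibrium

variable {n : ℕ} (G : SimpleGraph (Fin n)) [DecidableRel G.Adj]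

lemma lapMatrix_mulVec_eq_sum (a : Fin n → ℝ) (i : Fin n) :
    (G.lapMatrix ℝ *ᵥ a) i = ∑ j, G.adjMatrix ℝ i j * (a i - a j) := by
  rw [SimpleGraph.lapMatrix_mulVec_apply, SimpleGraph.degree_eq_sum_if_adj]
  simp only [mul_sub, Finset.sum_sub_distrib, SimpleGraph.adjMatrix_apply, Finset.sum_mul]
  congr 1
  rw [← SimpleGraph.adjMatrix_mulVec_apply]
  simp [mulVec, dotProduct, SimpleGraph.adjMatrix_apply]

/-- The payoff change from a unilateral deviation. -/
lemma agentPayoff_update (β : ℝ) (i : Fin n) (a x : Fin n → ℝ) (b : ℝ) :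
    agentPayoff G β i (Function.update a i b) x = agentPayoff G β i a x
      - 2 * (b - a i) * ((bestReplyMatrix G β *ᵥ a) i - x i)
      - (b - a i) ^ 2 * (1 + β * ∑ j, G.adjMatrix ℝ i j) := by
  have h1 : ∑ j, G.adjMatrix ℝ i j *
      (Function.update a i b i - Function.update a i b j) ^ 2
      = ∑ j, G.adjMatrix ℝ i j * (a i - a j) ^ 2
        + 2 * (b - a i) * (G.lapMatrix ℝ *ᵥ a) i
        + (b - a i) ^ 2 * ∑ j, G.adjMatrix ℝ i j := by
    rw [lapMatrix_mulVec_eq_sum, Finset.mul_sum, Finset.mul_sum, ← Finset.sum_add_distrib,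
      ← Finset.sum_add_distrib]
    refine Finset.sum_congr rfl fun j _ => ?_
    by_cases hij : j = i
    · subst hij; simp [SimpleGraph.adjMatrix_apply]
    · rw [Function.update_self, Function.update_of_ne hij]; ring
  simp only [agentPayoff]
  rw [h1, bestReplyMatrix_mulVec, Function.update_self]
  simp only [Pi.add_apply, Pi.smul_apply, smul_eq_mul]
  ring

variable {M : Type u} [MeasurableSpace M] {P : Measure (Fin n → ℝ)}
  [IsProbabilityMeasure P] (φ : Kernel (Fin n → ℝ) M) [IsMarkovKernel φ]

lemma condExpect_agentPayoff_update (β : ℝ) (i : Fin n) (a : Fin n → ℝ) (b : ℝ) {m : M}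
    (h1 : Integrable (fun x : Fin n → ℝ => x i) (posterior φ P m))
    (h2 : Integrable (fun x : Fin n → ℝ => x i ^ 2) (posterior φ P m)) :
    condExpect P φ (agentPayoff G β i (Function.update a i b)) m
      = condExpect P φ (agentPayoff G β i a) m
        - 2 * (b - a i) * ((bestReplyMatrix G β *ᵥ a) i - posteriorMean P φ m i)
        - (b - a i) ^ 2 * (1 + β * ∑ j, G.adjMatrix ℝ i j) := by
  have h3 : Integrable (agentPayoff G β i a) (posterior φ P m) := by
    have : agentPayoff G β i a = fun x => 2 * a i * x i - x i ^ 2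
        + (-(a i) ^ 2 - β * ∑ j, G.adjMatrix ℝ i j * (a i - a j) ^ 2) := by
      funext x; simp only [agentPayoff]; ring
    rw [this]
    exact ((h1.const_mul _).sub h2).add (integrable_const _)
  have h4 : Integrable (fun x : Fin n → ℝ => 2 * (b - a i) *
      ((bestReplyMatrix G β *ᵥ a) i - x i)) (posterior φ P m) :=
    ((integrable_const _).sub h1).const_mul _
  have h5 : Integrable (fun x : Fin n → ℝ => agentPayoff G β i a x - 2 * (b - a i) *
      ((bestReplyMatrix G β *ᵥ a) i - x i)) (posterior φ P m) := h3.sub h4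
  simp only [condExpect, agentPayoff_update, posteriorMean]
  rw [integral_sub h5 (integrable_const _), integral_sub h3 h4, integral_const_mul,
    integral_sub (integrable_const _) h1]
  simp

variable (hP : ∀ i, MemLp (fun x : Fin n → ℝ => x i) 2 P)
include hP

/-- The gain from a deviation is a strictly concave quadratic in its size with no constant term, so
no deviation pays exactly when the linear coefficient vanishes. -/
lemma isEquilibrium_iff {β : ℝ} (hβ : 0 ≤ β) (a : M → Fin n → ℝ) :
    IsEquilibrium G β P φ a ↔ Measurable a ∧
      ∀ᵐ m ∂(signalLaw P φ), bestReplyMatrix G β *ᵥ a m = posteriorMean P φ m := by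
  refine and_congr_right fun _ => Filter.eventually_congr ?_
  have h1 : ∀ᵐ m ∂(signalLaw P φ), ∀ i,
      Integrable (fun x : Fin n → ℝ => x i) (posterior φ P m) :=
    ae_all_iff.2 fun i => ae_integrable_posterior φ ((hP i).integrable one_le_two)
  have h2 : ∀ᵐ m ∂(signalLaw P φ), ∀ i,
      Integrable (fun x : Fin n → ℝ => x i ^ 2) (posterior φ P m) :=
    ae_all_iff.2 fun i => ae_integrable_posterior φ (hP i).integrable_sq
  filter_upwards [h1, h2] with m h1 h2
  have hpos : ∀ i, 0 < 1 + β * ∑ j, G.adjMatrix ℝ i j := fun i => by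
    have : 0 ≤ ∑ j, G.adjMatrix ℝ i j := Finset.sum_nonneg fun j _ => by
      rw [SimpleGraph.adjMatrix_apply]; split_ifs <;> norm_num
    positivity
  simp only [condExpect_agentPayoff_update G φ β _ _ _ (h1 _) (h2 _)]
  constructor
  · intro h
    funext i
    set F := (bestReplyMatrix G β *ᵥ a m) i - posteriorMean P φ m i with hF
    set D := 1 + β * ∑ j, G.adjMatrix ℝ i j with hD
    have hDpos : 0 < D := hpos i
    -- The vertex of the quadratic, where the gain equals F² / D.
    have h' := h i (a m i - F / D)
    have e : -(2 * (a m i - F / D - a m i) * F) - (a m i - F / D - a m i) ^ 2 * D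
        = F ^ 2 / D := by
      field_simp; ring
    have h'' : F ^ 2 / D ≤ 0 := by linarith
    have : F ^ 2 ≤ 0 := by
      by_contra! hc
      exact absurd h'' (not_le.2 (div_pos hc hDpos))
    have hF0 : F = 0 := by simpa using le_antisymm this (sq_nonneg F)
    linarith
  · intro h i b
    rw [h, sub_self, mul_zero, sub_zero]
    have := mul_nonneg (sq_nonneg (b - a m i)) (hpos i).le
    linarith

lemma isEquilibrium_inv {β : ℝ} (hβ : 0 ≤ β) :
    IsEquilibrium G β P φ (fun m => (bestReplyMatrix G β)⁻¹ *ᵥ posteriorMean P φ m) := by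
  rw [isEquilibrium_iff G φ hP hβ]
  refine ⟨?_, Filter.Eventually.of_forall fun m => ?_⟩
  · refine measurable_pi_lambda _ fun i => ?_
    simp only [mulVec, dotProduct]
    exact Finset.measurable_sum _ fun j _ =>
      ((measurable_pi_apply j).comp (measurable_posteriorMean φ)).const_mul _
  · rw [mulVec_mulVec, mul_nonsing_inv _ ((isUnit_iff_isUnit_det _).1
      (isUnit_bestReplyMatrix G hβ)), one_mulVec]

lemma IsEquilibrium.memLp {β : ℝ} (hβ : 0 ≤ β) {a : M → Fin n → ℝ}
    (ha : IsEquilibrium G β P φ a) (i : Fin n) :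
    MemLp (fun m => a m i) 2 (signalLaw P φ) := by
  have hθ : ∀ j, MemLp (fun m => posteriorMean P φ m j) 2 (signalLaw P φ) := fun j =>
    memLp_condExpect φ (measurable_pi_apply j) (hP j)
  have h : MemLp (fun m => ∑ j, (bestReplyMatrix G β)⁻¹ i j * posteriorMean P φ m j) 2
      (signalLaw P φ) := memLp_finsetSum _ fun j _ => (hθ j).const_mul _
  refine h.ae_eq ?_
  filter_upwards [((isEquilibrium_iff G φ hP hβ a).1 ha).2] with m hm
  rw [← show ((bestReplyMatrix G β)⁻¹ *ᵥ posteriorMean P φ m) i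
    = ∑ j, (bestReplyMatrix G β)⁻¹ i j * posteriorMean P φ m j from rfl, ← hm, mulVec_mulVec,
    nonsing_inv_mul _ ((isUnit_iff_isUnit_det _).1 (isUnit_bestReplyMatrix G hβ)), one_mulVec]

end Equilibrium

/-! ### The principal's loss relative to disclosing the average -/

section Value

variable {n : ℕ} (G : SimpleGraph (Fin n)) [DecidableRel G.Adj]
  {M : Type u} [MeasurableSpace M] {P : Measure (Fin n → ℝ)}
  [IsProbabilityMeasure P] (φ : Kernel (Fin n → ℝ) M) [IsMarkovKernel φ]

/-- The principal's payoff, net of the term that is independent of actions, once the state is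
replaced by its posterior mean in an equilibrium. -/
noncomputable def netPayoff (β : ℝ) (a : Fin n → ℝ) : ℝ :=
  2 * (a ⬝ᵥ (bestReplyMatrix G β *ᵥ a)) - a ⬝ᵥ a
    - β * ∑ i, ∑ j, (⊤ : SimpleGraph (Fin n)).adjMatrix ℝ i j * (a i - a j) ^ 2

lemma netPayoff_const (β t : ℝ) : netPayoff G β (fun _ => t) = n * t ^ 2 := by
  rw [netPayoff, bestReplyMatrix_mulVec_const]
  simp [dotProduct]
  ring

/-- The payoff of the principal when all agents learn exactly the average state. -/
noncomputable def averageValue (P : Measure (Fin n → ℝ)) : ℝ :=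
  ∫ x, n * average x ^ 2 - ∑ i, x i ^ 2 ∂P

/-- Loss of the principal, at a state and a realization, relative to disclosing the average. -/
noncomputable def gap (P : Measure (Fin n → ℝ)) [IsFiniteMeasure P] (β : ℝ) (a : M → Fin n → ℝ)
    (p : (Fin n → ℝ) × M) : ℝ :=
  n * (average p.1 - average (posteriorMean P φ p.2)) ^ 2
    + (n * average (posteriorMean P φ p.2) ^ 2 - netPayoff G β (a p.2))

variable (hP : ∀ i, MemLp (fun x : Fin n → ℝ => x i) 2 P)
include hP

lemma memLp_average_posteriorMean :
    MemLp (fun m => average (posteriorMean P φ m)) 2 (signalLaw P φ) := by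
  simp only [average_eq_sum]
  exact memLp_finsetSum _ fun i _ =>
    (memLp_condExpect φ (measurable_pi_apply i) (hP i)).const_mul _

lemma integrable_netPayoff {β : ℝ} (hβ : 0 ≤ β) {a : M → Fin n → ℝ}
    (ha : IsEquilibrium G β P φ a) :
    Integrable (fun m => netPayoff G β (a m)) (signalLaw P φ) := by
  have h := fun i => IsEquilibrium.memLp G φ hP hβ ha i
  have h1 : ∀ i j, Integrable (fun m => a m i * a m j) (signalLaw P φ) :=
    fun i j => (h i).integrable_mul (h j)
  have h2 : ∀ i j, Integrable (fun m => (a m i - a m j) ^ 2) (signalLaw P φ) :=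
    fun i j => ((h i).sub (h j)).integrable_sq
  simp only [netPayoff, dotProduct, mulVec, Finset.mul_sum]
  refine Integrable.sub (Integrable.sub ?_ ?_) ?_
  · refine integrable_finsetSum _ fun i _ => integrable_finsetSum _ fun j _ => ?_
    refine ((h1 i j).const_mul (2 * bestReplyMatrix G β i j)).congr
      (Filter.Eventually.of_forall fun m => ?_)
    simp only; ring
  · exact integrable_finsetSum _ fun i _ => h1 i i
  · exact integrable_finsetSum _ fun i _ => integrable_finsetSum _ fun j _ =>
      ((h2 i j).const_mul _).const_mul _

lemma integrable_gap {β : ℝ} (hβ : 0 ≤ β) {a : M → Fin n → ℝ}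
    (ha : IsEquilibrium G β P φ a) : Integrable (gap G φ P β a) (P.compProd φ) := by
  have h1 := memLp_fst φ (memLp_average hP)
  have h2 := memLp_snd φ (memLp_average_posteriorMean φ hP)
  have h3 := (measurePreserving_snd_compProd (P := P) φ).integrable_comp_of_integrable
    (integrable_netPayoff G φ hP hβ ha)
  exact ((h1.sub h2).integrable_sq.const_mul _).add ((h2.integrable_sq.const_mul _).sub h3)

lemma principalValue_eq {β : ℝ} (hβ : 0 ≤ β) {a : M → Fin n → ℝ}
    (ha : IsEquilibrium G β P φ a) :
    principalValue (⊤ : SimpleGraph (Fin n)) β P φ a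
      = averageValue P - ∫ p, gap G φ P β a p ∂(P.compProd φ) := by
  have hma : ∀ i, Measurable fun m => a m i := fun i => (measurable_pi_apply i).comp ha.1
  have hA := fun i => IsEquilibrium.memLp G φ hP hβ ha i
  have hJ1 := fun i => memLp_fst φ (hP i)
  have hJA := fun i => memLp_snd φ (hA i)
  have hJθ := fun i => memLp_snd φ (memLp_condExpect φ (measurable_pi_apply i) (hP i))
  have hav := memLp_fst φ (memLp_average hP)
  have hbv := memLp_snd φ (memLp_average_posteriorMean φ hP)
  have hmb : Measurable fun m => average (posteriorMean P φ m) :=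
    measurable_average.comp (measurable_posteriorMean φ)
  -- replace the state by its posterior mean in the cross terms
  have hcross : ∀ i, ∫ p, a p.2 i * p.1 i ∂(P.compProd φ)
      = ∫ p, a p.2 i * posteriorMean P φ p.2 i ∂(P.compProd φ) := fun i =>
    integral_snd_mul_fst φ (measurable_pi_apply i) (hP i) (hma i) (hA i)
  have hcross' : ∫ p, average (posteriorMean P φ p.2) * average p.1 ∂(P.compProd φ)
      = ∫ p, average (posteriorMean P φ p.2) ^ 2 ∂(P.compProd φ) := by
    rw [integral_snd_mul_fst φ measurable_average (memLp_average hP) hmb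
      (memLp_average_posteriorMean φ hP)]
    refine integral_congr_ae ?_
    filter_upwards [ae_snd φ (condExpect_average φ hP)] with p hp
    rw [hp, sq]
  have hI1 : ∀ i, Integrable (fun p : (Fin n → ℝ) × M => a p.2 i * p.1 i) (P.compProd φ) :=
    fun i => (hJA i).integrable_mul (hJ1 i)
  have hI2 : ∀ i, Integrable (fun p : (Fin n → ℝ) × M => a p.2 i * posteriorMean P φ p.2 i)
      (P.compProd φ) := fun i => (hJA i).integrable_mul (hJθ i)
  have hI3 : Integrable (fun p : (Fin n → ℝ) × M =>
      average (posteriorMean P φ p.2) * average p.1) (P.compProd φ) := hbv.integrable_mul hav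
  have hI4 := hbv.integrable_sq
  have hI5 : Integrable (fun x : Fin n → ℝ => n * average x ^ 2 - ∑ i, x i ^ 2) P :=
    ((memLp_average hP).integrable_sq.const_mul _).sub
      (integrable_finsetSum _ fun i _ => (hP i).integrable_sq)
  have hI5' : Integrable (fun p : (Fin n → ℝ) × M => n * average p.1 ^ 2 - ∑ i, p.1 i ^ 2)
      (P.compProd φ) :=
    (measurePreserving_fst_compProd (P := P) φ).integrable_comp_of_integrable hI5
  have hI6 : ∀ i, Integrable (fun p : (Fin n → ℝ) × M =>
      2 * (a p.2 i * p.1 i - a p.2 i * posteriorMean P φ p.2 i)) (P.compProd φ) :=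
    fun i => ((hI1 i).sub (hI2 i)).const_mul _
  have hI7 : Integrable (fun p : (Fin n → ℝ) × M =>
      2 * n * (average (posteriorMean P φ p.2) ^ 2
        - average (posteriorMean P φ p.2) * average p.1)) (P.compProd φ) :=
    (hI4.sub hI3).const_mul _
  have hvalue : averageValue P
      = ∫ p, (n * average p.1 ^ 2 - ∑ i, p.1 i ^ 2) ∂(P.compProd φ) := by
    have hmp := measurePreserving_fst_compProd (P := P) φ
    rw [averageValue, ← hmp.map_eq, integral_map measurable_fst.aemeasurable
      (by rw [hmp.map_eq]; exact hI5.1), hmp.map_eq]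
  -- These corrections have mean zero by the tower property. Adding them turns the claim into an
  -- almost sure identity of integrands.
  have hC : ∫ p, (∑ i, 2 * (a p.2 i * p.1 i - a p.2 i * posteriorMean P φ p.2 i)
      + 2 * n * (average (posteriorMean P φ p.2) ^ 2
        - average (posteriorMean P φ p.2) * average p.1)) ∂(P.compProd φ) = 0 := by
    rw [integral_add (integrable_finsetSum _ fun i _ => hI6 i) hI7,
      integral_finsetSum _ fun i _ => hI6 i,
      integral_const_mul, integral_sub hI4 hI3, hcross', sub_self, mul_zero, add_zero]
    refine Finset.sum_eq_zero fun i _ => ?_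
    rw [integral_const_mul, integral_sub (hI1 i) (hI2 i), hcross i, sub_self, mul_zero]
  have hCi : Integrable (fun p : (Fin n → ℝ) × M =>
      ∑ i, 2 * (a p.2 i * p.1 i - a p.2 i * posteriorMean P φ p.2 i)
      + 2 * n * (average (posteriorMean P φ p.2) ^ 2
        - average (posteriorMean P φ p.2) * average p.1)) (P.compProd φ) :=
    (integrable_finsetSum _ fun i _ => hI6 i).add hI7
  have hgap := integrable_gap G φ hP hβ ha
  have hI8 : Integrable (fun p : (Fin n → ℝ) × M =>
      n * average p.1 ^ 2 - ∑ i, p.1 i ^ 2 - gap G φ P β a p) (P.compProd φ) := hI5'.sub hgap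
  rw [hvalue, ← integral_sub hI5' hgap, ← add_zero (∫ p, _ ∂(P.compProd φ)), ← hC,
    ← integral_add hI8 hCi, principalValue]
  refine integral_congr_ae ?_
  filter_upwards [ae_snd φ ((isEquilibrium_iff G φ hP hβ a).1 ha).2] with p hp
  have e1 : ∑ i, (a p.2 i - p.1 i) ^ 2
      = a p.2 ⬝ᵥ a p.2 - 2 * ∑ i, a p.2 i * p.1 i + ∑ i, p.1 i ^ 2 := by
    rw [dotProduct, Finset.mul_sum, ← Finset.sum_sub_distrib, ← Finset.sum_add_distrib]
    exact Finset.sum_congr rfl fun i _ => by ring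
  have e2 : ∑ i, 2 * (a p.2 i * p.1 i - a p.2 i * posteriorMean P φ p.2 i)
      = 2 * ∑ i, a p.2 i * p.1 i - 2 * (a p.2 ⬝ᵥ posteriorMean P φ p.2) := by
    rw [dotProduct, ← Finset.mul_sum, Finset.sum_sub_distrib, mul_sub]
  simp only [principalPayoff, gap, netPayoff]
  rw [hp, e1, e2]
  ring

variable (hn : n ≠ 0) {β : ℝ} (hβ : 0 ≤ β)
  (hgap : 0 < 2 * β * (n - laplacianSpectralRadius G) - 1)
include hn hβ

lemma ae_le_gap {a : M → Fin n → ℝ} (ha : IsEquilibrium G β P φ a) :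
    ∀ᵐ p ∂(P.compProd φ), n * (average p.1 - average (posteriorMean P φ p.2)) ^ 2
      + (2 * β * (n - laplacianSpectralRadius G) - 1) * (deviation (a p.2) ⬝ᵥ deviation (a p.2))
        ≤ gap G φ P β a p := by
  filter_upwards [ae_snd φ ((isEquilibrium_iff G φ hP hβ a).1 ha).2] with p hp
  have h := teamPayoff_le G hn hβ (a p.2)
  rw [gap, netPayoff, ← hp, average_bestReplyMatrix_mulVec]
  linarith

include hgap

lemma ae_gap_nonneg {a : M → Fin n → ℝ} (ha : IsEquilibrium G β P φ a) :
    0 ≤ᵐ[P.compProd φ] gap G φ P β a := by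
  filter_upwards [ae_le_gap G φ hP hn hβ ha] with p hp
  have h : 0 ≤ deviation (a p.2) ⬝ᵥ deviation (a p.2) := by
    simpa using dotProduct_star_self_nonneg (deviation (a p.2))
  refine le_trans ?_ hp
  positivity

lemma principalValue_le {a : M → Fin n → ℝ} (ha : IsEquilibrium G β P φ a) :
    principalValue (⊤ : SimpleGraph (Fin n)) β P φ a ≤ averageValue P := by
  rw [principalValue_eq G φ hP hβ ha]
  have := integral_nonneg_of_ae (ae_gap_nonneg G φ hP hn hβ hgap ha)
  linarith

/-- The loss density is nonnegative, so equality of values means that it vanishes almost surely. The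
two squares bounding it from below must then both be zero. -/
lemma principalValue_eq_iff {a : M → Fin n → ℝ} (ha : IsEquilibrium G β P φ a) :
    principalValue (⊤ : SimpleGraph (Fin n)) β P φ a = averageValue P ↔
      ∀ᵐ p ∂(P.compProd φ), ∀ i, condExpect P φ (fun x => x i) p.2 = average p.1 := by
  have h0 : principalValue (⊤ : SimpleGraph (Fin n)) β P φ a = averageValue P ↔
      ∫ p, gap G φ P β a p ∂(P.compProd φ) = 0 := by
    rw [principalValue_eq G φ hP hβ ha]
    constructor <;> intro h <;> linarith
  rw [h0, integral_eq_zero_iff_of_nonneg_ae (ae_gap_nonneg G φ hP hn hβ hgap ha)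
    (integrable_gap G φ hP hβ ha)]
  refine Filter.eventually_congr ?_
  filter_upwards [ae_snd φ ((isEquilibrium_iff G φ hP hβ a).1 ha).2,
    ae_le_gap G φ hP hn hβ ha] with p hp hle
  have hnpos : (0 : ℝ) < n := by positivity
  constructor
  · intro h i
    rw [h, Pi.zero_apply] at hle
    have h1 : 0 ≤ deviation (a p.2) ⬝ᵥ deviation (a p.2) := by
      simpa using dotProduct_star_self_nonneg (deviation (a p.2))
    have h2 := mul_nonneg hgap.le h1
    have h3 := mul_nonneg hnpos.le (sq_nonneg (average p.1 - average (posteriorMean P φ p.2)))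
    have h4 : average p.1 - average (posteriorMean P φ p.2) = 0 := by
      have : (n : ℝ) * (average p.1 - average (posteriorMean P φ p.2)) ^ 2 = 0 := by linarith
      simpa [hn] using this
    have h5 : deviation (a p.2) = 0 := by
      have : (2 * β * (n - laplacianSpectralRadius G) - 1) *
        (deviation (a p.2) ⬝ᵥ deviation (a p.2)) = 0 := by linarith
      simpa [hgap.ne'] using this
    have h6 : a p.2 = fun _ => average (a p.2) :=
      funext fun j => sub_eq_zero.1 (congrFun h5 j)
    have h7 : posteriorMean P φ p.2 = fun _ => average (a p.2) := by
      rw [← hp]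
      conv_lhs => rw [h6]
      rw [bestReplyMatrix_mulVec_const]
    have h8 : average (posteriorMean P φ p.2) = average (a p.2) := by
      rw [← hp, average_bestReplyMatrix_mulVec]
    change posteriorMean P φ p.2 i = _
    rw [h7]
    linarith
  · intro h
    have h1 : posteriorMean P φ p.2 = fun _ => average p.1 := funext h
    -- The constant profile solves the system for a constant posterior mean, and the solution is
    -- unique.
    have h2 : a p.2 = fun _ => average p.1 := by
      refine mulVec_injective_iff_isUnit.2 (isUnit_bestReplyMatrix G hβ) ?_
      rw [hp, h1, bestReplyMatrix_mulVec_const]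
    have h3 : average (fun _ : Fin n => average p.1) = average p.1 := by
      generalize average p.1 = t
      simp [average, hn]
    rw [gap, h1, h2, netPayoff_const, h3]
    simp

end Value

end QuadraticTeam

/-! ### Exchangeability and nondegeneracy of the Gaussian prior -/

namespace QuadraticTeam

section Prior

variable {n : ℕ} (μ : ℝ) (σ : ℝ≥0)

lemma memLp_eval_prior (i : Fin n) :
    MemLp (fun x : Fin n → ℝ => x i) 2 (prior n μ σ) :=
  (memLp_id_gaussianReal 2).comp_measurePreserving
    (measurePreserving_eval (fun _ : Fin n => gaussianReal μ (σ ^ 2)) i)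

/-- Transposing coordinates i and j preserves both the i.i.d. prior and the average. -/
lemma integral_average_mul_eval (F : ℝ → ℝ) (i j : Fin n) :
    ∫ x, F (average x) * x i ∂(prior n μ σ) = ∫ x, F (average x) * x j ∂(prior n μ σ) := by
  set T := MeasurableEquiv.piCongrLeft (fun _ : Fin n => ℝ) (Equiv.swap i j) with hT
  have hmp : MeasurePreserving T (prior n μ σ) (prior n μ σ) :=
    measurePreserving_piCongrLeft (fun _ : Fin n => gaussianReal μ (σ ^ 2)) (Equiv.swap i j)
  have happ : ∀ x k, T x (Equiv.swap i j k) = x k := fun x k =>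
    Equiv.piCongrLeft_apply_apply (fun _ : Fin n => ℝ) (Equiv.swap i j) x k
  have havg : ∀ x, average (T x) = average x := fun x => by
    rw [average, average, ← Equiv.sum_comp (Equiv.swap i j)]
    simp only [happ]
  have hi : ∀ x, T x i = x j := fun x => by
    have := happ x j
    rwa [Equiv.swap_apply_right] at this
  rw [← hmp.integral_comp']
  simp only [havg, hi]

lemma integral_average_mul_eval_eq (hn : n ≠ 0) {F : ℝ → ℝ}
    (hF : ∀ i : Fin n, Integrable (fun x => F (average x) * x i) (prior n μ σ)) (i : Fin n) :
    ∫ x, F (average x) * x i ∂(prior n μ σ)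
      = ∫ x, F (average x) * average x ∂(prior n μ σ) := by
  have h : ∀ x : Fin n → ℝ, F (average x) * average x
      = ∑ j, (1 / (n : ℝ)) * (F (average x) * x j) := fun x => by
    rw [← Finset.mul_sum, ← Finset.mul_sum]
    nth_rewrite 2 [average]
    ring
  simp only [h]
  rw [integral_finsetSum _ fun j _ => (hF j).const_mul _]
  simp only [integral_const_mul, integral_average_mul_eval μ σ F _ i]
  simp [hn]

/-- A signal equivalent to the average state discloses the average state and, on each coordinate,
nothing else. -/
lemma condExpect_deterministic_average (hn : n ≠ 0) {N : Type v} [MeasurableSpace N]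
    {e : ℝ → N} (he : Measurable e) {T : N → ℝ} (hT : Measurable T) (hTe : ∀ t, T (e t) = t) :
    ∀ᵐ p ∂((prior n μ σ).compProd
        (Kernel.deterministic (fun x => e (average x)) (he.comp measurable_average))),
      ∀ i, condExpect (prior n μ σ)
        (Kernel.deterministic (fun x => e (average x)) (he.comp measurable_average))
        (fun x => x i) p.2 = average p.1 := by
  have hm : Measurable fun x : Fin n → ℝ => e (average x) := he.comp measurable_average
  set φ : Kernel (Fin n → ℝ) N := Kernel.deterministic (fun x => e (average x)) hm with hφ
  set P := prior n μ σ with hP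
  have hJ : P.compProd φ = P.map fun x => (x, e (average x)) := Measure.compProd_deterministic hm
  have hJm : Measurable fun x : Fin n → ℝ => (x, e (average x)) := measurable_id.prodMk hm
  have hρ : signalLaw P φ = P.map fun x => e (average x) := Measure.deterministic_comp_eq_map hm
  have hint : ∀ i, Integrable (fun x : Fin n → ℝ => x i) P :=
    fun i => (memLp_eval_prior μ σ i).integrable one_le_two
  have hTint : Integrable T (signalLaw P φ) := by
    rw [hρ, integrable_map_measure hT.aestronglyMeasurable hm.aemeasurable]
    simp only [Function.comp_def, hTe]
    exact (memLp_average (memLp_eval_prior μ σ)).integrable one_le_two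
  have key : ∀ i, ∀ᵐ m ∂(signalLaw P φ), condExpect P φ (fun x => x i) m = T m := fun i => by
    -- Tested on a set s of realizations, the claim becomes the exchangeability identity with F the
    -- indicator of s composed with e.
    refine Integrable.ae_eq_of_forall_setIntegral_eq _ _
      (integrable_condExpect φ (measurable_pi_apply i) (hint i)) hTint fun s hs _ => ?_
    set h : N → ℝ := s.indicator fun _ => 1 with hh
    have hhm : Measurable h := measurable_const.indicator hs
    have hb : ∀ m, ‖h m‖ ≤ 1 := fun m => by
      by_cases hms : m ∈ s <;> simp [hh, hms]
    have e1 : ∀ g : N → ℝ, ∫ m in s, g m ∂(signalLaw P φ)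
        = ∫ m, h m * g m ∂(signalLaw P φ) := fun g => by
      rw [← integral_indicator hs]
      refine integral_congr_ae (Filter.Eventually.of_forall fun m => ?_)
      by_cases hms : m ∈ s <;> simp [hh, hms]
    have hFint : ∀ j : Fin n, Integrable (fun x => h (e (average x)) * x j) P := fun j =>
      (hint j).bdd_mul (c := 1) (hhm.comp hm).aestronglyMeasurable
        (Filter.Eventually.of_forall fun x => hb _)
    have hmeas : Measurable fun p : (Fin n → ℝ) × N => h p.2 * p.1 i := by fun_prop
    have hJint : Integrable (fun p : (Fin n → ℝ) × N => h p.2 * p.1 i) (P.compProd φ) := by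
      rw [hJ, integrable_map_measure hmeas.aestronglyMeasurable hJm.aemeasurable]
      exact hFint i
    rw [e1, e1, ← integral_mul_condExpect φ hJint hhm (measurable_pi_apply i), hJ,
      integral_map hJm.aemeasurable hmeas.aestronglyMeasurable, hρ,
      integral_map hm.aemeasurable (Measurable.aestronglyMeasurable (f := fun m => h m * T m)
        (hhm.mul hT))]
    simp only [hTe]
    exact integral_average_mul_eval_eq μ σ hn (F := fun t => h (e t)) hFint i
  have hT' : ∀ᵐ p ∂(P.compProd φ), T p.2 = average p.1 := by
    rw [hJ, ae_map_iff (p := fun p => T p.2 = average p.1) hJm.aemeasurable (measurableSet_eq_fun (hT.comp measurable_snd)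
      (measurable_average.comp measurable_fst))]
    exact Filter.Eventually.of_forall fun x => hTe _
  filter_upwards [ae_snd φ (ae_all_iff.2 key), hT'] with p h1 h2 i
  rw [h1 i, h2]

/-- By independence the linear form has variance σ² ∑ d_i², which must be zero. -/
lemma eq_zero_of_ae_linear_eq_zero (hσ : 0 < σ) {d : Fin n → ℝ}
    (h : ∀ᵐ x ∂(prior n μ σ), ∑ i, d i * x i = 0) (i : Fin n) : d i = 0 := by
  have h1 : Var[∑ i, fun x : Fin n → ℝ => d i * x i; prior n μ σ]
      = ∑ i, Var[fun t => d i * t; gaussianReal μ (σ ^ 2)] :=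
    variance_sum_pi (X := fun i t => d i * t)
      fun i => (memLp_id_gaussianReal (μ := μ) (v := σ ^ 2) 2).const_mul (d i)
  have h2 : (∑ i, fun x : Fin n → ℝ => d i * x i) =ᵐ[prior n μ σ] fun _ => (0 : ℝ) := by
    filter_upwards [h] with x hx
    rw [Finset.sum_apply, hx]
  have h3 : ∀ i, Var[fun t => d i * t; gaussianReal μ (σ ^ 2)] = d i ^ 2 * (σ : ℝ) ^ 2 :=
    fun i => by
      rw [variance_const_mul, variance_fun_id_gaussianReal]
      simp
  have h4 : Var[fun _ : Fin n → ℝ => (0 : ℝ); prior n μ σ] = 0 := variance_zero _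
  rw [variance_congr h2, h4] at h1
  simp only [h3] at h1
  have h5 := (Finset.sum_eq_zero_iff_of_nonneg fun i _ => by positivity).1 h1.symm i
    (Finset.mem_univ i)
  have : (σ : ℝ) ≠ 0 := by exact_mod_cast hσ.ne'
  simpa [this] using h5

end Prior

/-! ### Characterization of optimal signals and of what they reveal -/

section Optimality

variable {n : ℕ} (G : SimpleGraph (Fin n)) [DecidableRel G.Adj] (μ : ℝ) (σ : ℝ≥0)
  {M : Type u} [MeasurableSpace M] (φ : Kernel (Fin n → ℝ) M) [IsMarkovKernel φ]

lemma isOptimalSignal_iff (hn : n ≠ 0) {β : ℝ} (hβ : 0 ≤ β)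
    (hgap : 0 < 2 * β * (n - laplacianSpectralRadius G) - 1) :
    IsOptimalSignal.{u, v} G (⊤ : SimpleGraph (Fin n)) β (prior n μ σ) φ ↔
      ∀ᵐ p ∂((prior n μ σ).compProd φ), ∀ i : Fin n,
        condExpect (prior n μ σ) φ (fun x => x i) p.2 = average p.1 := by
  have hP := memLp_eval_prior (n := n) μ σ
  constructor
  · rintro ⟨⟨a, ha⟩, hopt⟩
    rw [← principalValue_eq_iff G φ hP hn hβ hgap ha]
    refine le_antisymm (principalValue_le G φ hP hn hβ hgap ha) ?_
    have hup : Measurable (ULift.up : ℝ → ULift.{v} ℝ) := MeasurableEquiv.ulift.symm.measurable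
    have hdown : Measurable (ULift.down : ULift.{v} ℝ → ℝ) := MeasurableEquiv.ulift.measurable
    -- Competing signals take values in universe v, so the benchmark that discloses the average uses
    -- a lifted copy of the reals.
    set ψ : Kernel (Fin n → ℝ) (ULift.{v} ℝ) :=
      Kernel.deterministic (fun x => ULift.up (average x)) (hup.comp measurable_average) with hψ
    have hb := isEquilibrium_inv G ψ hP hβ
    rw [← (principalValue_eq_iff G ψ hP hn hβ hgap hb).2
      (condExpect_deterministic_average μ σ hn hup hdown fun _ => rfl)]
    exact hopt a ha _ ψ _ hb
  · intro h
    refine ⟨⟨_, isEquilibrium_inv G φ hP hβ⟩, fun a ha N _ ψ _ b hb => ?_⟩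
    rw [(principalValue_eq_iff G φ hP hn hβ hgap ha).2 h]
    exact principalValue_le G ψ hP hn hβ hgap hb

lemma informs_average (hn : n ≠ 0)
    (h : ∀ᵐ p ∂((prior n μ σ).compProd φ), ∀ i : Fin n,
      condExpect (prior n μ σ) φ (fun x => x i) p.2 = average p.1) :
    Informs (prior n μ σ) φ average := by
  filter_upwards [h, ae_snd φ (condExpect_average φ (memLp_eval_prior μ σ))] with p h1 h2
  have h3 : posteriorMean (prior n μ σ) φ p.2 = fun _ => average p.1 := funext h1
  rw [h2, h3]
  generalize average p.1 = t
  simp [average, hn]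

lemma informs_linear_iff (hn : n ≠ 0) (hσ : 0 < σ)
    (h : ∀ᵐ p ∂((prior n μ σ).compProd φ), ∀ i : Fin n,
      condExpect (prior n μ σ) φ (fun x => x i) p.2 = average p.1) (c : Fin n → ℝ) :
    Informs (prior n μ σ) φ (fun x => ∑ i, c i * x i) ↔ ∃ t : ℝ, ∀ i, c i = t := by
  have hn' : (n : ℝ) ≠ 0 := Nat.cast_ne_zero.2 hn
  have h0 : Informs (prior n μ σ) φ (fun x => ∑ i, c i * x i) ↔
      ∀ᵐ p ∂((prior n μ σ).compProd φ), ∑ i, (c i - average c) * p.1 i = 0 := by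
    refine Filter.eventually_congr ?_
    filter_upwards [h, ae_snd φ (condExpect_linear φ (memLp_eval_prior μ σ))] with p h1 h2
    have h3 : posteriorMean (prior n μ σ) φ p.2 = fun _ => average p.1 := funext h1
    -- The left side is the posterior mean of the statistic, so being informed of it amounts to ∑
    -- (c_i - c̄) x_i = 0.
    have h4 : (∑ i, c i) * average p.1 = average c * ∑ i, p.1 i := by
      simp only [average]; ring
    rw [h2, h3]
    simp only [sub_mul, Finset.sum_sub_distrib, ← Finset.sum_mul, ← Finset.mul_sum, h4]
    rw [sub_eq_zero, eq_comm]
  rw [h0]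
  constructor
  · intro h1
    rw [← ae_map_iff (p := fun x : Fin n → ℝ => ∑ i, (c i - average c) * x i = 0)
      measurable_fst.aemeasurable (measurableSet_eq_fun (by fun_prop) measurable_const),
      (measurePreserving_fst_compProd φ).map_eq] at h1
    exact ⟨average c, fun i => sub_eq_zero.1 (eq_zero_of_ae_linear_eq_zero μ σ hσ h1 i)⟩
  · rintro ⟨t, ht⟩
    have h1 : average c = t := by
      rw [average]
      simp [ht, hn']
    simp [ht, h1]

end Optimality

end QuadraticTeam

theorem proposition7 {n : ℕ} (G : SimpleGraph (Fin n)) [DecidableRel G.Adj]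
    (hG : Gᶜ.Connected) (μ : ℝ) (σ : ℝ≥0) (hσ : 0 < σ) :
    QuadraticTeam.laplacianSpectralRadius G < n ∧
    ∀ β : ℝ, 1 / (2 * ((n : ℝ) - QuadraticTeam.laplacianSpectralRadius G)) < β →
      QuadraticTeam.IsOptimalSignal.{0, v} G (⊤ : SimpleGraph (Fin n)) β
        (QuadraticTeam.prior n μ σ) (QuadraticTeam.averageSignal n) ∧
      ∀ (M : Type u) [MeasurableSpace M] (φ : Kernel (Fin n → ℝ) M) [IsMarkovKernel φ],
        (QuadraticTeam.IsOptimalSignal.{u, v} G (⊤ : SimpleGraph (Fin n)) β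
            (QuadraticTeam.prior n μ σ) φ ↔
          ∀ᵐ p ∂((QuadraticTeam.prior n μ σ).compProd φ), ∀ i : Fin n,
            QuadraticTeam.condExpect (QuadraticTeam.prior n μ σ) φ (fun x => x i) p.2 =
              QuadraticTeam.average p.1) ∧
        (QuadraticTeam.IsOptimalSignal.{u, v} G (⊤ : SimpleGraph (Fin n)) β
            (QuadraticTeam.prior n μ σ) φ →
          QuadraticTeam.Informs (QuadraticTeam.prior n μ σ) φ QuadraticTeam.average ∧
          ∀ c : Fin n → ℝ,
            QuadraticTeam.Informs (QuadraticTeam.prior n μ σ) φ (fun x => ∑ i, c i * x i) ↔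
              ∃ t : ℝ, ∀ i, c i = t) := by
  have hn : n ≠ 0 := Fin.pos_iff_nonempty.2 hG.nonempty |>.ne'
  have hlt := QuadraticTeam.laplacianSpectralRadius_lt G hG
  refine ⟨hlt, fun β hβ => ?_⟩
  have hpos : 0 < 2 * ((n : ℝ) - QuadraticTeam.laplacianSpectralRadius G) := by linarith
  have hβ0 : 0 ≤ β := (lt_trans (by positivity) hβ).le
  -- The threshold on β is exactly strict positivity of the penalty on deviations.
  have hgap : 0 < 2 * β * (n - QuadraticTeam.laplacianSpectralRadius G) - 1 := by
    rw [div_lt_iff₀ hpos] at hβ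
    linarith
  refine ⟨?_, fun M _ φ _ => ?_⟩
  · exact (QuadraticTeam.isOptimalSignal_iff G μ σ _ hn hβ0 hgap).2
      (QuadraticTeam.condExpect_deterministic_average μ σ hn measurable_id measurable_id
        fun _ => rfl)
  · have hiff := QuadraticTeam.isOptimalSignal_iff.{u, v} G μ σ φ hn hβ0 hgap
    exact ⟨hiff, fun hopt => ⟨QuadraticTeam.informs_average μ σ φ hn (hiff.1 hopt),
      QuadraticTeam.informs_linear_iff μ σ φ hn hσ (hiff.1 hopt)⟩⟩
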